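/- Let $N$ be a nonnegative integer and let $\hat A\in\mathbb R^{N\times N}$ be a matrix with zero row sums and nonnegative off-diagonal entries. Let $\{A(t)\}_{t\ge 0}$ be the time-invariant chain $A(t)=\hat A$ for all $t\ge 0$. For a chain $\{A(t)\}_{t\ge 0}$ let $\Phi(t,\tau)$, $t\ge\tau\ge 0$, be the state transition matrix of $\dot x(t)=A(t)x(t)$, given by the Peano–Baker series $$\Phi(t,\tau)=I+\int_\tau^t A(\sigma_1)\,d\sigma_1+\int_\tau^t A(\sigma_1)\int_\tau^{\sigma_1}A(\sigma_2)\,d\sigma_2\,d\sigma_1+\cdots.$$ Let $\mathbf{Null}_\tau(A)=\{v\in\mathbb R^N : \lim_{t\to\infty}\Phi(t,\tau)v=0\}$. Let $\mathbf{Nullity}(A)=\dim\mathbf{Null}_0(A)$, and let $\mathbf{Rank}(A)=N-\mathbf{Nullity}(A)$. The unbounded interactions graph of the chain is the directed graph on $\{1,\dots,N\}$ with a link from $i$ to $j$, $i\ne j$, if and only if $\int_0^\infty a_{ji}(t)\,dt=\infty$. An s-root of a directed graph is a set $S$ of nodes such that every node is in $S$ or is reachable along a directed path from some node of $S$. Then,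 for the time-invariant chain $A(t)=\hat A$: $\dim\mathbf{Null}_\tau(A)=\mathbf{Nullity}(A)$ for every $\tau\ge 0$; $\mathbf{Rank}(A)=\mathrm{nullity}(\hat A)$, the dimension of the kernel of $\hat A$; and $\mathbf{Rank}(A)$ equals the size of the smallest s-root of the unbounded interactions graph of $\{A(t)\}$. -/

import Mathlib

open MeasureTheory Filter Topology

noncomputable section

/-- The terms of the Peano-Baker series of the chain `A` with initial time `τ`: the `0`-th term is
the identity matrix, and the next term at time `t` is the (entrywise) integral over `[τ, t]` of
`A σ` times the previous term at time `σ`. -/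
def peanoBakerTerm {N : ℕ} (A : ℝ → Matrix (Fin N) (Fin N) ℝ) (τ : ℝ) :
    ℕ → ℝ → Matrix (Fin N) (Fin N) ℝ
  | 0, _ => 1
  | k + 1, t => Matrix.of fun i j => ∫ σ in τ..t, (A σ * peanoBakerTerm A τ k σ) i j

/-- The state transition matrix `Φ(t, τ)` of the chain `A`, as the sum of its Peano-Baker series.
For `t ≥ τ ≥ 0` it depends only on the values of `A` at nonnegative times. -/
def stateTransition {N : ℕ} (A : ℝ → Matrix (Fin N) (Fin N) ℝ) (t τ : ℝ) :
    Matrix (Fin N) (Fin N) ℝ :=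
  Matrix.of fun i j => ∑' k : ℕ, peanoBakerTerm A τ k t i j

/-- The null space of the chain `A` at time `τ`: all vectors `v` with `Φ(t, τ) v → 0` as
`t → ∞`. -/
def chainNull {N : ℕ} (A : ℝ → Matrix (Fin N) (Fin N) ℝ) (τ : ℝ) :
    Submodule ℝ (Fin N → ℝ) where
  carrier := {v | Tendsto (fun t : ℝ => (stateTransition A t τ).mulVec v) atTop (𝓝 0)}
  add_mem' := by
    intro a b ha hb
    simp only [Set.mem_ofPred_eq, Matrix.mulVec_add] at ha hb ⊢
    simpa using ha.add hb
  zero_mem' := by simp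
  smul_mem' := by
    intro c v hv
    simp only [Set.mem_ofPred_eq, Matrix.mulVec_smul] at hv ⊢
    simpa using hv.const_smul c

/-- The nullity of the chain `A`: the dimension of its null space, taken at time `0` (the dimension
at any other time `τ ≥ 0` is the same). -/
def chainNullity {N : ℕ} (A : ℝ → Matrix (Fin N) (Fin N) ℝ) : ℕ :=
  Module.finrank ℝ (chainNull A 0)

/-- The rank of the chain `A`. The nullity is at most `N`, so the subtraction does not truncate. -/
def chainRank {N : ℕ} (A : ℝ → Matrix (Fin N) (Fin N) ℝ) : ℕ :=
  N - chainNullity A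

/-- The unbounded interactions graph of the chain `A`: for distinct `i`, `j` there is a link from
`i` to `j` if and only if the integral of `a_{ji}` over `[0, ∞)` is infinite. (Off-diagonal entries
of a chain are nonnegative, so the integral is the Lebesgue integral with values in `[0, ∞]`.) -/
def unboundedInteractionsGraph {N : ℕ} (A : ℝ → Matrix (Fin N) (Fin N) ℝ) : Digraph (Fin N) where
  Adj i j := i ≠ j ∧ ∫⁻ t in Set.Ici (0 : ℝ), ENNReal.ofReal (A t j i) = ⊤

/-- `S` is an s-root of the directed graph `G`: every node belongs to `S` or is reachable along a
directed path from some node of `S`. -/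
def IsSRoot {V : Type*} (G : Digraph V) (S : Finset V) : Prop :=
  ∀ i : V, i ∈ S ∨ ∃ j ∈ S, Relation.TransGen G.Adj j i

end

/-! The Peano–Baker series sums to `exp ((t - τ) B)`. With `B = c (P - 1)` and `P` stochastic,
Poisson concentration gives `exp (s B) B → 0` (`tendsto_exp_smul_sub_one_mul`), so the null space
contains the range of `B`. It meets `ker B` trivially, because the exponential fixes kernel vectors.
Hence the two dimensions add to `N` (`finrank_chainNull`).

Kernel vectors are harmonic functions on the graph. By the maximum principle they are determined by
their values on any s-root, and on a minimal s-root these values are arbitrary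
(`kerRestrict_injective`, `kerRestrict_surjective`). -/

open scoped Matrix.Norms.Operator

/-! ### Harmonic vectors and s-roots. -/

section GraphPart

variable {N : ℕ} {B : Matrix (Fin N) (Fin N) ℝ}

/-- The directed graph of the positive off-diagonal entries: `i → j` when `0 < B j i`. -/
def posGraph (B : Matrix (Fin N) (Fin N) ℝ) (i j : Fin N) : Prop := i ≠ j ∧ 0 < B j i

lemma unboundedInteractionsGraph_adj_iff {A : ℝ → Matrix (Fin N) (Fin N) ℝ}
    (hA : ∀ t : ℝ, 0 ≤ t → A t = B) (i j : Fin N) :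
    (unboundedInteractionsGraph A).Adj i j ↔ posGraph B i j := by
  have h : ∫⁻ t in Set.Ici (0 : ℝ), ENNReal.ofReal (A t j i)
      = ENNReal.ofReal (B j i) * ⊤ := by
    rw [setLIntegral_congr_fun (g := fun _ => ENNReal.ofReal (B j i)) measurableSet_Ici]
    · simp
    · intro t ht
      simp only [hA t ht]
  change (i ≠ j ∧ _ = ⊤) ↔ _
  rw [h, posGraph]
  refine and_congr_right fun _ => ?_
  rcases lt_or_ge 0 (B j i) with hp | hp
  · simp [hp, ENNReal.mul_top]
  · simp [ENNReal.ofReal_of_nonpos hp, hp]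

lemma isSRoot_iff {A : ℝ → Matrix (Fin N) (Fin N) ℝ}
    (hA : ∀ t : ℝ, 0 ≤ t → A t = B) (S : Finset (Fin N)) :
    IsSRoot (unboundedInteractionsGraph A) S ↔
      ∀ i, ∃ s ∈ S, Relation.ReflTransGen (posGraph B) s i := by
  have h : (unboundedInteractionsGraph A).Adj = posGraph B := by
    ext i j
    exact unboundedInteractionsGraph_adj_iff hA i j
  rw [IsSRoot, h]
  refine forall_congr' fun i => ⟨?_, ?_⟩
  · rintro (hi | ⟨s, hs, hsi⟩)
    · exact ⟨i, hi, .refl⟩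
    · exact ⟨s, hs, hsi.to_reflTransGen⟩
  · rintro ⟨s, hs, hsi⟩
    rcases Relation.reflTransGen_iff_eq_or_transGen.1 hsi with h | h
    · exact .inl (h ▸ hs)
    · exact .inr ⟨s, hs, h⟩

lemma mulVec_apply_eq_sum_sub (hrow : ∀ i, ∑ j, B i j = 0) (v : Fin N → ℝ) (i : Fin N) :
    B.mulVec v i = ∑ j, B i j * (v j - v i) := by
  simp only [Matrix.mulVec, dotProduct, mul_sub, Finset.sum_sub_distrib, ← Finset.sum_mul,
    hrow, zero_mul, sub_zero]

/-- If `v` is harmonic at `i` and maximal there among `i` and its predecessors, it takes the same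
value at every predecessor. -/
lemma eq_of_posGraph_of_harmonic (hrow : ∀ i, ∑ j, B i j = 0)
    (hoff : ∀ i j, i ≠ j → 0 ≤ B i j) {v : Fin N → ℝ} {i j : Fin N}
    (hv : B.mulVec v i = 0) (hmax : ∀ k, posGraph B k i → v k ≤ v i) (hj : posGraph B j i) :
    v j = v i := by
  rw [mulVec_apply_eq_sum_sub hrow] at hv
  have hle : ∀ k ∈ Finset.univ, B i k * (v k - v i) ≤ 0 := by
    intro k _
    rcases eq_or_ne k i with rfl | hk
    · simp
    · rcases (hoff i k hk.symm).eq_or_lt with h | h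
      · simp [← h]
      · exact mul_nonpos_of_nonneg_of_nonpos h.le (sub_nonpos.2 (hmax k ⟨hk, h⟩))
  have h := (Finset.sum_eq_zero_iff_of_nonpos hle).1 hv j (Finset.mem_univ j)
  rcases mul_eq_zero.1 h with h | h
  · exact absurd h hj.2.ne'
  · linarith

/-- Walk the path backwards from `i`: at a node off `S` the maximal value passes to its predecessor,
and the walk meets `S` at `s` at the latest. -/
lemma exists_root_eq_of_isMax (hrow : ∀ i, ∑ j, B i j = 0)
    (hoff : ∀ i j, i ≠ j → 0 ≤ B i j) {S : Finset (Fin N)} {v : Fin N → ℝ}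
    (hv : ∀ i ∉ S, B.mulVec v i = 0) {s i : Fin N} (hs : s ∈ S)
    (hsi : Relation.ReflTransGen (posGraph B) s i)
    (hmax : ∀ k, Relation.ReflTransGen (posGraph B) k i → v k ≤ v i) :
    ∃ r ∈ S, Relation.ReflTransGen (posGraph B) r i ∧ v r = v i := by
  induction hsi with
  | refl => exact ⟨s, hs, .refl, rfl⟩
  | @tail j i _ hji ih =>
    by_cases hi : i ∈ S
    · exact ⟨i, hi, .refl, rfl⟩
    · have hj : v j = v i := eq_of_posGraph_of_harmonic hrow hoff (hv i hi)
        (fun k hk => hmax k (.single hk)) hji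
      obtain ⟨r, hr, hrj, hrv⟩ := ih fun k hk => hj ▸ hmax k (hk.tail hji)
      exact ⟨r, hr, hrj.tail hji, hrv.trans hj⟩

/-- Maximum principle: a vector harmonic off an s-root `S` is bounded above at `i` by its values
at the elements of `S` from which `i` is reachable. -/
lemma le_of_forall_root_le (hrow : ∀ i, ∑ j, B i j = 0)
    (hoff : ∀ i j, i ≠ j → 0 ≤ B i j) {S : Finset (Fin N)}
    (hS : ∀ i, ∃ s ∈ S, Relation.ReflTransGen (posGraph B) s i) {v : Fin N → ℝ}
    (hv : ∀ i ∉ S, B.mulVec v i = 0) {i : Fin N} {c : ℝ}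
    (hc : ∀ s ∈ S, Relation.ReflTransGen (posGraph B) s i → v s ≤ c) : v i ≤ c := by
  classical
  obtain ⟨m, hm, hmax⟩ := Finset.exists_max_image
    (Finset.univ.filter fun k => Relation.ReflTransGen (posGraph B) k i) v ⟨i, by simp [Relation.ReflTransGen.refl]⟩
  simp only [Finset.mem_filter, Finset.mem_univ, true_and] at hm hmax
  obtain ⟨s, hs, hsm⟩ := hS m
  obtain ⟨r, hr, hrm, hrv⟩ := exists_root_eq_of_isMax hrow hoff hv hs hsm
    fun k hk => hmax k (hk.trans hm)
  exact (hmax i .refl).trans (hrv ▸ hc r hr (hrm.trans hm))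

lemma eq_of_forall_root_eq (hrow : ∀ i, ∑ j, B i j = 0)
    (hoff : ∀ i j, i ≠ j → 0 ≤ B i j) {S : Finset (Fin N)}
    (hS : ∀ i, ∃ s ∈ S, Relation.ReflTransGen (posGraph B) s i) {v : Fin N → ℝ}
    (hv : ∀ i ∉ S, B.mulVec v i = 0) {i : Fin N} {c : ℝ}
    (hc : ∀ s ∈ S, Relation.ReflTransGen (posGraph B) s i → v s = c) : v i = c := by
  refine le_antisymm (le_of_forall_root_le hrow hoff hS hv fun s hs h => (hc s hs h).le) ?_
  have h := le_of_forall_root_le hrow hoff hS (v := -v) (i := i) (c := -c)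
    (fun i hi => by simp [Matrix.mulVec_neg, hv i hi]) fun s hs h => by simp [hc s hs h]
  simpa using h

/-- Restriction of the kernel of `B` to the coordinates in `S`. -/
def kerRestrict (B : Matrix (Fin N) (Fin N) ℝ) (S : Finset (Fin N)) :
    LinearMap.ker B.mulVecLin →ₗ[ℝ] (S → ℝ) :=
  (LinearMap.funLeft ℝ ℝ (Subtype.val : S → Fin N)).comp (LinearMap.ker B.mulVecLin).subtype

lemma kerRestrict_injective (hrow : ∀ i, ∑ j, B i j = 0)
    (hoff : ∀ i j, i ≠ j → 0 ≤ B i j) {S : Finset (Fin N)}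
    (hS : ∀ i, ∃ s ∈ S, Relation.ReflTransGen (posGraph B) s i) :
    Function.Injective (kerRestrict B S) := by
  rw [injective_iff_map_eq_zero]
  rintro ⟨v, hv⟩ h
  ext i
  refine eq_of_forall_root_eq hrow hoff hS (fun i _ => congrFun hv i) fun s hs _ => ?_
  exact congrFun h ⟨s, hs⟩

lemma finrank_ker_le_card (hrow : ∀ i, ∑ j, B i j = 0)
    (hoff : ∀ i j, i ≠ j → 0 ≤ B i j) {S : Finset (Fin N)}
    (hS : ∀ i, ∃ s ∈ S, Relation.ReflTransGen (posGraph B) s i) :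
    Module.finrank ℝ (LinearMap.ker B.mulVecLin) ≤ S.card := by
  simpa using LinearMap.finrank_le_finrank_of_injective (kerRestrict_injective hrow hoff hS)

/-- Every prescription of values on an s-root has a harmonic extension. -/
lemma exists_harmonic_extension (hrow : ∀ i, ∑ j, B i j = 0)
    (hoff : ∀ i j, i ≠ j → 0 ≤ B i j) {S : Finset (Fin N)}
    (hS : ∀ i, ∃ s ∈ S, Relation.ReflTransGen (posGraph B) s i) (u : Fin N → ℝ) :
    ∃ v : Fin N → ℝ, (∀ s ∈ S, v s = u s) ∧ ∀ i ∉ S, B.mulVec v i = 0 := by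
  classical
  -- A square system: values on `S`, harmonicity off `S`. The maximum principle makes it injective,
  -- hence surjective.
  let L : (Fin N → ℝ) →ₗ[ℝ] (Fin N → ℝ) :=
    LinearMap.pi fun i => if i ∈ S then LinearMap.proj i else (LinearMap.proj i).comp B.mulVecLin
  have hmem (v : Fin N → ℝ) {i : Fin N} (hi : i ∈ S) : L v i = v i := by simp [L, hi]
  have hnot (v : Fin N → ℝ) {i : Fin N} (hi : i ∉ S) : L v i = B.mulVec v i := by simp [L, hi]
  have hinj : Function.Injective L := by
    rw [injective_iff_map_eq_zero]
    intro v hv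
    ext i
    refine eq_of_forall_root_eq hrow hoff hS (fun j hj => ?_) fun s hs _ => ?_
    · rw [← hnot v hj, hv, Pi.zero_apply]
    · rw [← hmem v hs, hv, Pi.zero_apply, Pi.zero_apply]
  obtain ⟨v, hv⟩ := LinearMap.injective_iff_surjective.1 hinj fun i => if i ∈ S then u i else 0
  refine ⟨v, fun s hs => ?_, fun i hi => ?_⟩
  · simp [← hmem v hs, hv, hs]
  · simp [← hnot v hi, hv, hi]

/-- The harmonic extension is also harmonic at `i ∈ S`: a root reaching a predecessor of `i` reaches
`i`, so it is `i`, and `v` is constant on `i` and its predecessors. -/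
lemma kerRestrict_surjective (hrow : ∀ i, ∑ j, B i j = 0)
    (hoff : ∀ i j, i ≠ j → 0 ≤ B i j) {S : Finset (Fin N)}
    (hS : ∀ i, ∃ s ∈ S, Relation.ReflTransGen (posGraph B) s i)
    (hindep : ∀ s ∈ S, ∀ r ∈ S, Relation.ReflTransGen (posGraph B) r s → r = s) :
    Function.Surjective (kerRestrict B S) := by
  classical
  intro u
  obtain ⟨v, hvS, hv⟩ := exists_harmonic_extension hrow hoff hS
    fun i => if h : i ∈ S then u ⟨i, h⟩ else 0
  refine ⟨⟨v, ?_⟩, ?_⟩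
  · ext i
    by_cases hi : i ∈ S
    · change B.mulVec v i = 0
      rw [mulVec_apply_eq_sum_sub hrow]
      refine Finset.sum_eq_zero fun j _ => ?_
      rcases eq_or_ne j i with rfl | hj
      · simp
      · rcases (hoff i j hj.symm).eq_or_lt with h | h
        · simp [← h]
        · have hvj : v j = v i := eq_of_forall_root_eq hrow hoff hS hv fun s hs hsj => by
            rw [hindep i hi s hs (hsj.tail ⟨hj, h⟩)]
          simp [hvj]
    · exact hv i hi
  · ext ⟨s, hs⟩
    change v s = _
    rw [hvS s hs, dif_pos hs]

/-- A smallest s-root has as many elements as the dimension of the kernel. -/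
lemma exists_root_card_eq (hrow : ∀ i, ∑ j, B i j = 0) (hoff : ∀ i j, i ≠ j → 0 ≤ B i j) :
    ∃ S : Finset (Fin N), (∀ i, ∃ s ∈ S, Relation.ReflTransGen (posGraph B) s i) ∧
      S.card = Module.finrank ℝ (LinearMap.ker B.mulVecLin) := by
  classical
  obtain ⟨S, hS, hmin⟩ := Finset.exists_min_image
    (Finset.univ.filter fun S : Finset (Fin N) =>
      ∀ i, ∃ s ∈ S, Relation.ReflTransGen (posGraph B) s i) Finset.card
    ⟨Finset.univ, by simpa using fun i => ⟨i, .refl⟩⟩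
  simp only [Finset.mem_filter, Finset.mem_univ, true_and] at hS hmin
  have hindep : ∀ s ∈ S, ∀ r ∈ S, Relation.ReflTransGen (posGraph B) r s → r = s := by
    intro s hs r hr hrs
    by_contra hne
    -- Everything reached from `s` is reached from `r`, so `s` is redundant.
    refine (Finset.card_erase_lt_of_mem hs).not_ge (hmin (S.erase s) fun i => ?_)
    obtain ⟨t, ht, hti⟩ := hS i
    rcases eq_or_ne t s with rfl | hts
    · exact ⟨r, Finset.mem_erase.2 ⟨hne, hr⟩, hrs.trans hti⟩
    · exact ⟨t, Finset.mem_erase.2 ⟨hts, ht⟩, hti⟩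
  refine ⟨S, hS, ?_⟩
  have h := (LinearEquiv.ofBijective (kerRestrict B S)
    ⟨kerRestrict_injective hrow hoff hS, kerRestrict_surjective hrow hoff hS hindep⟩).finrank_eq
  simpa using h.symm

end GraphPart

/-! ### Poisson averages of powers. -/

section Poisson

lemma hasSum_pow_div_factorial (s : ℝ) :
    HasSum (fun k : ℕ => s ^ k / k.factorial) (Real.exp s) := by
  rw [Real.exp_eq_exp_ℝ]
  exact NormedSpace.expSeries_div_hasSum_exp s

/-- Shifting the exponential series: `∑ (sᵏ / k!) k f k = s ∑ (sᵏ / k!) f (k + 1)`. -/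
lemma hasSum_natCast_smul_of_succ {E : Type*} [NormedAddCommGroup E] [NormedSpace ℝ E]
    {s : ℝ} {f : ℕ → E} {a : E}
    (h : HasSum (fun k : ℕ => (s ^ k / k.factorial) • f (k + 1)) a) :
    HasSum (fun k : ℕ => (s ^ k / k.factorial * k) • f k) (s • a) := by
  rw [← hasSum_nat_add_iff' 1]
  simp only [Finset.range_one, Finset.sum_singleton, Nat.cast_zero, mul_zero, zero_smul, sub_zero]
  convert h.const_smul s using 2 with k
  rw [smul_smul]
  congr 1
  have : (k.factorial : ℝ) ≠ 0 := by positivity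
  have : (k + 1 : ℝ) ≠ 0 := by positivity
  rw [Nat.factorial_succ]
  push_cast
  field_simp
  ring

/-- The variance of the Poisson distribution, unnormalized and rescaled. -/
lemma hasSum_poisson_variance {s : ℝ} (hs : 0 < s) :
    HasSum (fun k : ℕ => s ^ k / k.factorial * (k / s - 1) ^ 2) (Real.exp s / s) := by
  have h0 := hasSum_pow_div_factorial s
  have h1 : HasSum (fun k : ℕ => s ^ k / k.factorial * k) (s * Real.exp s) := by
    simpa using hasSum_natCast_smul_of_succ (f := fun _ => (1 : ℝ)) (by simpa using h0)
  have h2 : HasSum (fun k : ℕ => s ^ k / k.factorial * k * k)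
      (s * (s * Real.exp s + Real.exp s)) := by
    refine hasSum_natCast_smul_of_succ (f := fun k => (k : ℝ)) ?_
    simpa [mul_add] using h1.add h0
  have h := ((h2.mul_left (1 / s ^ 2)).sub (h1.mul_left (2 / s))).add h0
  convert h using 1
  · rfl
  · funext k
    field_simp
    ring
  · field_simp
    ring

variable {R : Type*} [NormedRing R] [NormedAlgebra ℝ R] [CompleteSpace R]

lemma hasSum_exp_smul (s : ℝ) (P : R) :
    HasSum (fun k : ℕ => (s ^ k / k.factorial) • P ^ k) (NormedSpace.exp (s • P)) := by
  convert NormedSpace.exp_series_hasSum_exp' (𝕂 := ℝ) (s • P) using 2 with k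
  rw [smul_pow, smul_smul]
  congr 1
  ring

lemma hasSum_exp_smul_mul_sub_one {s : ℝ} (hs : 0 < s) (P : R) :
    HasSum (fun k : ℕ => (s ^ k / k.factorial * (k / s - 1)) • P ^ k)
      (NormedSpace.exp (s • P) * (P - 1)) := by
  have h0 := hasSum_exp_smul s P
  have h1 : HasSum (fun k : ℕ => (s ^ k / k.factorial * k) • P ^ k)
      (s • (NormedSpace.exp (s • P) * P)) := by
    refine hasSum_natCast_smul_of_succ ?_
    simpa [pow_succ] using h0.mul_right P
  convert (h1.const_smul (1 / s)).sub h0 using 1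
  · rfl
  · funext k
    rw [smul_smul, ← sub_smul]
    congr 1
    field_simp
  · rw [smul_smul, one_div_mul_cancel hs.ne', one_smul, mul_sub, mul_one]

/-- The coefficients are Poisson weights, up to the factor `exp s`, times the deviation `y = k / s -
1`. The bound `|y| ≤ ε + y ^ 2 / ε` reduces the mean of `|y|` to the variance `1 / s`. -/
lemma norm_exp_smul_mul_sub_one_le {s ε : ℝ} (hs : 0 < s) (hε : 0 < ε) {P : R}
    (hP : ∀ k : ℕ, ‖P ^ k‖ ≤ 1) :
    ‖NormedSpace.exp (s • P) * (P - 1)‖ ≤ Real.exp s * (ε + 1 / (ε * s)) := by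
  have h0 := (hasSum_pow_div_factorial s).mul_left ε
  have h2 := (hasSum_poisson_variance hs).mul_left (1 / ε)
  have h := h0.add h2
  rw [← (hasSum_exp_smul_mul_sub_one hs P).tsum_eq]
  refine (tsum_of_norm_bounded h fun k => ?_).trans (le_of_eq (by field_simp))
  have hp : 0 ≤ s ^ k / (k.factorial : ℝ) := by positivity
  have habs : |(k / s - 1 : ℝ)| ≤ ε + 1 / ε * (k / s - 1) ^ 2 := by
    rw [← sq_abs, ← sub_nonneg]
    set y := |(k / s - 1 : ℝ)|
    have : ε + 1 / ε * y ^ 2 - y = ((ε - y / 2) ^ 2 + 3 / 4 * y ^ 2) / ε := by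
      field_simp
      ring
    rw [this]
    positivity
  calc ‖(s ^ k / k.factorial * (k / s - 1)) • P ^ k‖
      ≤ ‖(s ^ k / k.factorial * (k / s - 1) : ℝ)‖ * 1 := by
        rw [norm_smul]
        exact mul_le_mul_of_nonneg_left (hP k) (norm_nonneg _)
    _ = s ^ k / k.factorial * |(k / s - 1 : ℝ)| := by
        rw [mul_one, Real.norm_eq_abs, abs_mul, abs_of_nonneg hp]
    _ ≤ s ^ k / k.factorial * (ε + 1 / ε * (k / s - 1) ^ 2) :=
        mul_le_mul_of_nonneg_left habs hp
    _ = _ := by ring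

lemma exp_smul_sub_one (s : ℝ) (P : R) :
    NormedSpace.exp (s • (P - 1)) = Real.exp (-s) • NormedSpace.exp (s • P) := by
  have h : s • (P - 1) = algebraMap ℝ R (-s) + s • P := by
    rw [Algebra.algebraMap_eq_smul_one, smul_sub, neg_smul]
    abel
  let : NormedAlgebra ℚ R := NormedAlgebra.restrictScalars ℚ ℝ R
  rw [h, NormedSpace.exp_add_of_commute (Algebra.commutes _ _),
    ← NormedSpace.algebraMap_exp_comm, ← Real.exp_eq_exp_ℝ, ← Algebra.smul_def]

/-- For a power-bounded element `P`, `exp (s (P - 1)) (P - 1)` tends to zero. -/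
lemma tendsto_exp_smul_sub_one_mul {P : R} (hP : ∀ k : ℕ, ‖P ^ k‖ ≤ 1) :
    Tendsto (fun s : ℝ => NormedSpace.exp (s • (P - 1)) * (P - 1)) atTop (𝓝 0) := by
  rw [Metric.tendsto_atTop]
  intro δ hδ
  -- With `ε = δ / 4`, this threshold makes `1 / (ε s) ≤ δ / 4`.
  refine ⟨16 / δ ^ 2, fun s hs => ?_⟩
  have hspos : 0 < s := lt_of_lt_of_le (by positivity) hs
  have h := norm_exp_smul_mul_sub_one_le hspos (show 0 < δ / 4 by positivity) hP
  rw [dist_zero_right, exp_smul_sub_one, smul_mul_assoc, norm_smul, Real.norm_eq_abs, Real.abs_exp]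
  calc _ ≤ Real.exp (-s) * (Real.exp s * (δ / 4 + 1 / (δ / 4 * s))) :=
        mul_le_mul_of_nonneg_left h (Real.exp_pos _).le
    _ = δ / 4 + 1 / (δ / 4 * s) := by
        rw [← mul_assoc, ← Real.exp_add, neg_add_cancel, Real.exp_zero, one_mul]
    _ ≤ δ / 4 + δ / 4 := by
        rw [ge_iff_le, div_le_iff₀ (by positivity)] at hs
        refine add_le_add_right ?_ _
        rw [div_le_iff₀ (by positivity)]
        nlinarith
    _ < δ := by linarith

end Poisson

/-! ### The transition matrix and its null space. -/

section ChainPart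

variable {N : ℕ} {B : Matrix (Fin N) (Fin N) ℝ}

/-- The norm in force is the largest absolute row sum. -/
lemma norm_le_one_of_stochastic {P : Matrix (Fin N) (Fin N) ℝ} (h0 : ∀ i j, 0 ≤ P i j)
    (h1 : ∀ i, ∑ j, P i j = 1) : ‖P‖ ≤ 1 := by
  rw [Matrix.linfty_opNorm_def]
  norm_cast
  refine Finset.sup_le fun i _ => ?_
  rw [← NNReal.coe_le_coe]
  push_cast
  simp only [Real.norm_eq_abs, abs_of_nonneg (h0 _ _), h1, le_refl]

lemma exists_stochastic (hrow : ∀ i, ∑ j, B i j = 0) (hoff : ∀ i j, i ≠ j → 0 ≤ B i j) :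
    ∃ (c : ℝ) (P : Matrix (Fin N) (Fin N) ℝ), 0 < c ∧ B = c • (P - 1) ∧
      (∀ i j, 0 ≤ P i j) ∧ ∀ i, ∑ j, P i j = 1 := by
  -- Dominating every `|B i i|` keeps the diagonal of `1 + c⁻¹ • B` nonnegative; the summand `1`
  -- ensures `c > 0` even for `B = 0`.
  have hc : 0 < 1 + ∑ i, |B i i| := by positivity
  set c := 1 + ∑ i, |B i i| with hcdef
  refine ⟨c, 1 + c⁻¹ • B, hc, ?_, fun i j => ?_, fun i => ?_⟩
  · rw [add_sub_cancel_left, smul_smul, mul_inv_cancel₀ hc.ne', one_smul]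
  · rcases eq_or_ne i j with rfl | h
    · have h1 : |B i i| ≤ ∑ i, |B i i| :=
        Finset.single_le_sum (f := fun i => |B i i|) (fun _ _ => abs_nonneg _) (Finset.mem_univ i)
      have h2 := neg_abs_le (B i i)
      have h3 : 1 + c⁻¹ * B i i = c⁻¹ * (c + B i i) := by field_simp
      simp only [Matrix.add_apply, Matrix.one_apply_eq, Matrix.smul_apply, smul_eq_mul, h3]
      exact mul_nonneg (inv_nonneg.2 hc.le) (by linarith)
    · simp only [Matrix.add_apply, Matrix.one_apply_ne h, Matrix.smul_apply, smul_eq_mul, zero_add]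
      exact mul_nonneg (inv_nonneg.2 hc.le) (hoff i j h)
  · simp [Finset.sum_add_distrib, ← Finset.mul_sum, hrow, Matrix.one_apply]

lemma tendsto_exp_smul_mul (hrow : ∀ i, ∑ j, B i j = 0) (hoff : ∀ i j, i ≠ j → 0 ≤ B i j) :
    Tendsto (fun s : ℝ => NormedSpace.exp (s • B) * B) atTop (𝓝 0) := by
  obtain ⟨c, P, hc, rfl, h0, h1⟩ := exists_stochastic hrow hoff
  have hP : ‖P‖ ≤ 1 := norm_le_one_of_stochastic h0 h1
  have hPk : ∀ k : ℕ, ‖P ^ k‖ ≤ 1 := by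
    intro k
    induction k with
    | zero =>
      rw [pow_zero]
      -- The identity is itself stochastic; this covers `N = 0`, where its norm is `0`.
      exact norm_le_one_of_stochastic (fun i j => by rw [Matrix.one_apply]; split_ifs <;> simp)
        fun i => by simp [Matrix.one_apply]
    | succ k ih =>
      rw [pow_succ]
      exact (norm_mul_le _ _).trans (mul_le_one₀ ih (norm_nonneg _) hP)
  have h := ((tendsto_exp_smul_sub_one_mul hPk).comp (tendsto_id.atTop_mul_const hc)).const_smul c
  simp only [Function.comp_def, id, smul_zero] at h
  simp only [mul_smul_comm, smul_smul]
  exact h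

lemma peanoBakerTerm_eq {A : ℝ → Matrix (Fin N) (Fin N) ℝ} (hA : ∀ t : ℝ, 0 ≤ t → A t = B)
    {τ : ℝ} (hτ : 0 ≤ τ) (k : ℕ) {t : ℝ} (ht : τ ≤ t) :
    peanoBakerTerm A τ k t = ((t - τ) ^ k / k.factorial) • B ^ k := by
  induction k generalizing t with
  | zero => simp [peanoBakerTerm]
  | succ k ih =>
    ext i j
    simp only [peanoBakerTerm, Matrix.of_apply]
    have hcongr : Set.EqOn (fun σ => (A σ * peanoBakerTerm A τ k σ) i j)
        (fun σ => (σ - τ) ^ k * ((B ^ (k + 1)) i j / k.factorial)) (Set.uIcc τ t) := by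
      intro σ hσ
      rw [Set.uIcc_of_le ht] at hσ
      simp only [hA σ (hτ.trans hσ.1), ih hσ.1, Matrix.mul_smul, ← pow_succ', Matrix.smul_apply,
        smul_eq_mul]
      ring
    rw [intervalIntegral.integral_congr hcongr, intervalIntegral.integral_mul_const,
      intervalIntegral.integral_comp_sub_right (fun x => x ^ k) τ, integral_pow, Nat.factorial_succ,
      Matrix.smul_apply, smul_eq_mul]
    have : (k.factorial : ℝ) ≠ 0 := by positivity
    have : (k + 1 : ℝ) ≠ 0 := by positivity
    push_cast
    simp only [sub_self]
    field_simp
    ring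

lemma stateTransition_eq_exp {A : ℝ → Matrix (Fin N) (Fin N) ℝ} (hA : ∀ t : ℝ, 0 ≤ t → A t = B)
    {τ t : ℝ} (hτ : 0 ≤ τ) (ht : τ ≤ t) :
    stateTransition A t τ = NormedSpace.exp ((t - τ) • B) := by
  ext i j
  have h := hasSum_exp_smul (t - τ) B
  have hij := Pi.hasSum.1 (Pi.hasSum.1 h i) j
  simp only [stateTransition, Matrix.of_apply, peanoBakerTerm_eq hA hτ _ ht]
  exact hij.tsum_eq

lemma mem_chainNull_iff {A : ℝ → Matrix (Fin N) (Fin N) ℝ} (hA : ∀ t : ℝ, 0 ≤ t → A t = B)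
    {τ : ℝ} (hτ : 0 ≤ τ) (v : Fin N → ℝ) :
    v ∈ chainNull A τ ↔
      Tendsto (fun s : ℝ => (NormedSpace.exp (s • B)).mulVec v) atTop (𝓝 0) := by
  change Tendsto (fun t : ℝ => (stateTransition A t τ).mulVec v) atTop (𝓝 0) ↔ _
  have h : (fun t : ℝ => (stateTransition A t τ).mulVec v) =ᶠ[atTop]
      (fun s : ℝ => (NormedSpace.exp (s • B)).mulVec v) ∘ fun t => t - τ := by
    filter_upwards [eventually_ge_atTop τ] with t ht
    simp [stateTransition_eq_exp hA hτ ht]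
  rw [tendsto_congr' h, ← tendsto_map'_iff, map_sub_atTop_eq]

lemma exp_mulVec_of_mem_ker {v : Fin N → ℝ} (hv : B.mulVec v = 0) (s : ℝ) :
    (NormedSpace.exp (s • B)).mulVec v = v := by
  have hcont : Continuous fun M : Matrix (Fin N) (Fin N) ℝ => M.mulVec v :=
    continuous_id.matrix_mulVec continuous_const
  have h := (hasSum_exp_smul s B).map (Matrix.mulVecBilin ℝ ℝ |>.flip v) hcont
  refine h.unique ?_
  convert hasSum_single (0 : ℕ) ?_ using 1
  · simp
  · intro k hk
    obtain ⟨k, rfl⟩ := Nat.exists_eq_succ_of_ne_zero hk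
    simp [pow_succ, hv]

lemma finrank_chainNull (hrow : ∀ i, ∑ j, B i j = 0) (hoff : ∀ i j, i ≠ j → 0 ≤ B i j)
    {A : ℝ → Matrix (Fin N) (Fin N) ℝ} (hA : ∀ t : ℝ, 0 ≤ t → A t = B) {τ : ℝ} (hτ : 0 ≤ τ) :
    Module.finrank ℝ (chainNull A τ) + Module.finrank ℝ (LinearMap.ker B.mulVecLin) = N := by
  have hrange : LinearMap.range B.mulVecLin ≤ chainNull A τ := by
    rintro _ ⟨w, rfl⟩
    rw [mem_chainNull_iff hA hτ]
    have hcont : Continuous fun M : Matrix (Fin N) (Fin N) ℝ => M.mulVec w :=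
      continuous_id.matrix_mulVec continuous_const
    have h := (hcont.tendsto 0).comp (tendsto_exp_smul_mul hrow hoff)
    simpa [Function.comp_def, ← Matrix.mulVec_mulVec] using h
  have hdisj : chainNull A τ ⊓ LinearMap.ker B.mulVecLin = ⊥ := by
    rw [eq_bot_iff]
    rintro v ⟨hv, hker⟩
    have hv' := (mem_chainNull_iff hA hτ v).1 hv
    simp only [exp_mulVec_of_mem_ker (show B.mulVec v = 0 from hker)] at hv'
    exact tendsto_nhds_unique tendsto_const_nhds hv'
  -- Rank–nullity with `hrange` gives `≥ N`; the trivial intersection gives `≤ N`.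
  have h1 := Submodule.finrank_mono hrange
  have h2 := LinearMap.finrank_range_add_finrank_ker B.mulVecLin
  have h3 := Submodule.finrank_sup_add_finrank_inf_eq (chainNull A τ) (LinearMap.ker B.mulVecLin)
  have h4 := Submodule.finrank_le (chainNull A τ ⊔ LinearMap.ker B.mulVecLin)
  rw [hdisj, finrank_bot] at h3
  rw [Module.finrank_fin_fun] at h2 h4
  omega

end ChainPart

theorem corollary5 (N : ℕ) (Ahat : Matrix (Fin N) (Fin N) ℝ)
    (hrow : ∀ i : Fin N, ∑ j : Fin N, Ahat i j = 0)
    (hoff : ∀ i j : Fin N, i ≠ j → 0 ≤ Ahat i j)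
    (A : ℝ → Matrix (Fin N) (Fin N) ℝ)
    (hA : ∀ t : ℝ, 0 ≤ t → A t = Ahat) :
    (∀ τ : ℝ, 0 ≤ τ → Module.finrank ℝ (chainNull A τ) = chainNullity A) ∧
    chainRank A = Module.finrank ℝ (LinearMap.ker Ahat.mulVecLin) ∧
    IsLeast {k : ℕ | ∃ S : Finset (Fin N),
      IsSRoot (unboundedInteractionsGraph A) S ∧ S.card = k} (chainRank A) := by
  have hdim {τ : ℝ} (hτ : 0 ≤ τ) := finrank_chainNull hrow hoff hA hτ
  have hrank : chainRank A = Module.finrank ℝ (LinearMap.ker Ahat.mulVecLin) := by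
    have h := hdim le_rfl
    rw [chainRank, chainNullity]
    omega
  refine ⟨fun τ hτ => ?_, hrank, ?_, ?_⟩
  · have h := hdim le_rfl
    have h' := hdim hτ
    rw [chainNullity]
    omega
  · obtain ⟨S, hS, hcard⟩ := exists_root_card_eq hrow hoff
    exact ⟨S, (isSRoot_iff hA S).2 hS, hcard.trans hrank.symm⟩
  · rintro _ ⟨S, hS, rfl⟩
    rw [hrank]
    exact finrank_ker_le_card hrow hoff ((isSRoot_iff hA S).1 hS)
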